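/- Let $R$ be an associative ring with identity, let $\mathrm{Mod}\,R$ and $\mathrm{Mod}\,R^{op}$ be the categories of left and right $R$-modules, and write $M^+=\mathrm{Hom}_{\mathbb Z}(M,\mathbb Q/\mathbb Z)$ for the character module of a left (resp. right) $R$-module $M$, which is a right (resp. left) $R$-module. All subcategories are full, additive (they contain $0$ and are closed under finite direct sums) and closed under isomorphisms. For a subcategory $\mathcal X$ of a module category $\mathcal A$: - the right Gorenstein subcategory $r\mathcal G(\mathcal X)$ consists of all $A$ such that $\mathrm{Ext}^{i}(A,X)=0$ for all $X\in\mathcal X$ and $i\ge 1$, and such that there is an exact sequence $0\to A\to X^0\to X^1\to\cdots$ with all $X^i\in\mathcal X$ which remains exact under $\mathrm{Hom}(-,X)$ for every $X\in\mathcal X$; - the left Gorenstein subcategory $l\mathcal G(\mathcal X)$ consists of all $A$ such that $\mathrm{Ext}^{i}(X,A)=0$ for all $X\in\mathcal X$ and $i\ge 1$, and such that there is an exact sequence $\cdots\to X_1\to X_0\to A\to 0$ with all $X_i\in\mathcal X$ which remains exact under $\mathrm{Hom}(X,-)$ for every $X\in\mathcal X$; - $\mathcal X$ is preenveloping in $\mathcal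 A$ if every $A\in\mathcal A$ admits a morphism $f:A\to X$ with $X\in\mathcal X$ such that $\mathrm{Hom}(f,X'):\mathrm{Hom}(X,X')\to\mathrm{Hom}(A,X')$ is surjective for every $X'\in\mathcal X$. A short exact sequence in $\mathrm{Mod}\,R$ is pure if $\mathrm{Hom}_R(M,-)$ preserves its exactness for every finitely presented $M$; a module $E$ is pure injective if $\mathrm{Hom}_R(-,E)$ preserves exactness of every pure short exact sequence. **Proposition 3.2.** Let $\mathcal C$ and $\mathcal D$ be subcategories of $\mathrm{Mod}\,R$ and $\mathrm{Mod}\,R^{op}$ respectively such that (a) $D^+\in\mathcal C$ for all $D\in\mathcal D$, and $C^+\in\mathcal D$ for all $C\in\mathcal C$; (b) $\mathcal C$ is preenveloping in $\mathrm{Mod}\,R$ and every module in $\mathcal C$ is pure injective; (c) $\mathrm{Ext}^{i}_{R^{op}}(D,C^+)=0$ for all $D\in\mathcal D$, $C\in\mathcal C$ and $i\ge 1$. Then for every $A\in\mathrm{Mod}\,R$, one has $A\in r\mathcal G(\mathcal C)$ if and only if $A^+\in l\mathcal G(\mathcal D)$. -/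

import Mathlib

open CategoryTheory MulOpposite

universe w v u

namespace GorensteinSub

/-! ### Right and left Gorenstein subcategories of an abelian category

A (full) subcategory is given by the property of belonging to it. -/

section AbelianCategory

variable {𝒜 : Type u} [Category.{v} 𝒜] [Abelian 𝒜]

/-- `Ext^{≥ 1}(X, Y) = 0`. -/
def ExtVanish [HasExt.{w} 𝒜] (X Y : 𝒜) : Prop :=
  ∀ n : ℕ, 1 ≤ n → Subsingleton (Abelian.Ext.{w} X Y n)

/-- The orthogonal class `⊥P` of all `A` with `Ext^{≥ 1}(A, X) = 0` for all `X` in `P`. -/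
def leftPerp [HasExt.{w} 𝒜] (P : ObjectProperty 𝒜) : ObjectProperty 𝒜 :=
  fun A => ∀ X : 𝒜, P X → ExtVanish.{w} A X

/-- The orthogonal class `P⊥` of all `A` with `Ext^{≥ 1}(X, A) = 0` for all `X` in `P`. -/
def rightPerp [HasExt.{w} 𝒜] (P : ObjectProperty 𝒜) : ObjectProperty 𝒜 :=
  fun A => ∀ X : 𝒜, P X → ExtVanish.{w} X A

/-- The sequence `0 ⟶ A ⟶ X 0 ⟶ X 1 ⟶ ⋯` with maps `ε` and `d i` is exact. -/
structure IsCoresolution {A : 𝒜} {X : ℕ → 𝒜} (ε : A ⟶ X 0) (d : ∀ i, X i ⟶ X (i + 1)) :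
    Prop where
  mono : Mono ε
  exact_zero : ∃ h : ε ≫ d 0 = 0, (ShortComplex.mk ε (d 0) h).Exact
  exact_succ : ∀ i, ∃ h : d i ≫ d (i + 1) = 0, (ShortComplex.mk (d i) (d (i + 1)) h).Exact

/-- The sequence `⋯ ⟶ Hom(X 1, Y) ⟶ Hom(X 0, Y) ⟶ Hom(A, Y) ⟶ 0` is exact. -/
structure HomIntoExact {A : 𝒜} {X : ℕ → 𝒜} (ε : A ⟶ X 0) (d : ∀ i, X i ⟶ X (i + 1)) (Y : 𝒜) :
    Prop where
  surjective : Function.Surjective (fun g : X 0 ⟶ Y => ε ≫ g)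
  exact_zero : Function.Exact (fun g : X 1 ⟶ Y => d 0 ≫ g) (fun g : X 0 ⟶ Y => ε ≫ g)
  exact_succ : ∀ i, Function.Exact (fun g : X (i + 2) ⟶ Y => d (i + 1) ≫ g)
    (fun g : X (i + 1) ⟶ Y => d i ≫ g)

/-- The class of all `A` with a `Hom(-, P)`-exact exact sequence `0 ⟶ A ⟶ X 0 ⟶ X 1 ⟶ ⋯`
whose terms `X i` all lie in `P`. -/
def coresTilde (P : ObjectProperty 𝒜) : ObjectProperty 𝒜 :=
  fun A => ∃ (X : ℕ → 𝒜) (ε : A ⟶ X 0) (d : ∀ i, X i ⟶ X (i + 1)),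
    (∀ i, P (X i)) ∧ IsCoresolution ε d ∧ ∀ Y : 𝒜, P Y → HomIntoExact ε d Y

/-- The sequence `⋯ ⟶ X 1 ⟶ X 0 ⟶ A ⟶ 0` with maps `d i` and `ε` is exact. -/
structure IsResolution {A : 𝒜} {X : ℕ → 𝒜} (ε : X 0 ⟶ A) (d : ∀ i, X (i + 1) ⟶ X i) :
    Prop where
  epi : Epi ε
  exact_zero : ∃ h : d 0 ≫ ε = 0, (ShortComplex.mk (d 0) ε h).Exact
  exact_succ : ∀ i, ∃ h : d (i + 1) ≫ d i = 0, (ShortComplex.mk (d (i + 1)) (d i) h).Exact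

/-- The sequence `⋯ ⟶ Hom(Y, X 1) ⟶ Hom(Y, X 0) ⟶ Hom(Y, A) ⟶ 0` is exact. -/
structure HomFromExact {A : 𝒜} {X : ℕ → 𝒜} (ε : X 0 ⟶ A) (d : ∀ i, X (i + 1) ⟶ X i) (Y : 𝒜) :
    Prop where
  surjective : Function.Surjective (fun g : Y ⟶ X 0 => g ≫ ε)
  exact_zero : Function.Exact (fun g : Y ⟶ X 1 => g ≫ d 0) (fun g : Y ⟶ X 0 => g ≫ ε)
  exact_succ : ∀ i, Function.Exact (fun g : Y ⟶ X (i + 2) => g ≫ d (i + 1))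
    (fun g : Y ⟶ X (i + 1) => g ≫ d i)

/-- The class of all `A` with a `Hom(P, -)`-exact exact sequence `⋯ ⟶ X 1 ⟶ X 0 ⟶ A ⟶ 0`
whose terms `X i` all lie in `P`. -/
def resTilde (P : ObjectProperty 𝒜) : ObjectProperty 𝒜 :=
  fun A => ∃ (X : ℕ → 𝒜) (ε : X 0 ⟶ A) (d : ∀ i, X (i + 1) ⟶ X i),
    (∀ i, P (X i)) ∧ IsResolution ε d ∧ ∀ Y : 𝒜, P Y → HomFromExact ε d Y

/-- The right Gorenstein subcategory relative to `P`. -/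
def rightGorenstein [HasExt.{w} 𝒜] (P : ObjectProperty 𝒜) : ObjectProperty 𝒜 :=
  fun A => leftPerp.{w} P A ∧ coresTilde P A

/-- The left Gorenstein subcategory relative to `P`. -/
def leftGorenstein [HasExt.{w} 𝒜] (P : ObjectProperty 𝒜) : ObjectProperty 𝒜 :=
  fun A => rightPerp.{w} P A ∧ resTilde P A

/-- The morphism `f : A ⟶ X` is a `P`-preenvelope of `A`. -/
def IsPreenvelope (P : ObjectProperty 𝒜) {A X : 𝒜} (f : A ⟶ X) : Prop :=
  P X ∧ ∀ X' : 𝒜, P X' → Function.Surjective (fun g : X ⟶ X' => f ≫ g)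

/-- Every object of the category has a `P`-preenvelope. -/
def IsPreenveloping (P : ObjectProperty 𝒜) : Prop :=
  ∀ A : 𝒜, ∃ (X : 𝒜) (f : A ⟶ X), IsPreenvelope P f

end AbelianCategory

/-! ### Pure injective modules -/

section Pure

variable {R : Type u} [Ring R]

/-- The short exact sequence `S` is pure: for every finitely presented `M`, the sequence
`0 ⟶ Hom(M, S.X₁) ⟶ Hom(M, S.X₂) ⟶ Hom(M, S.X₃) ⟶ 0` is exact. -/
def IsPureExact (S : ShortComplex (ModuleCat.{u} R)) : Prop :=
  S.ShortExact ∧ ∀ M : ModuleCat.{u} R, Module.FinitePresentation R M →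
    Function.Injective (fun h : M ⟶ S.X₁ => h ≫ S.f) ∧
    Function.Exact (fun h : M ⟶ S.X₁ => h ≫ S.f) (fun h : M ⟶ S.X₂ => h ≫ S.g) ∧
    Function.Surjective (fun h : M ⟶ S.X₂ => h ≫ S.g)

/-- `E` is pure injective: for every pure short exact sequence `S`, the sequence
`0 ⟶ Hom(S.X₃, E) ⟶ Hom(S.X₂, E) ⟶ Hom(S.X₁, E) ⟶ 0` is exact. -/
def IsPureInjective (E : ModuleCat.{u} R) : Prop :=
  ∀ S : ShortComplex (ModuleCat.{u} R), IsPureExact S →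
    Function.Injective (fun h : S.X₃ ⟶ E => S.g ≫ h) ∧
    Function.Exact (fun h : S.X₃ ⟶ E => S.g ≫ h) (fun h : S.X₂ ⟶ E => S.f ≫ h) ∧
    Function.Surjective (fun h : S.X₂ ⟶ E => S.f ≫ h)

end Pure

/-! ### Character modules over a noncommutative ring

`CharacterModule M` is the abelian group `Hom_ℤ(M, ℚ/ℤ)`; right `R`-modules are modules over
`Rᵐᵒᵖ`. -/

section Character

variable {R : Type u} [Ring R]

/-- The character group of a left `R`-module is a right `R`-module via `(f · r)(x) = f (r x)`. -/
abbrev rightModuleCharacter (M : Type u) [AddCommGroup M] [Module R M] :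
    Module Rᵐᵒᵖ (CharacterModule M) where
  smul r f := AddMonoidHom.comp (f : M →+ AddCircle (1 : ℚ))
    (DistribSMul.toAddMonoidHom M (unop r))
  one_smul f := by
    ext x; exact congrArg f (one_smul R x)
  mul_smul r s f := by
    ext x; exact congrArg f (mul_smul (unop s) (unop r) x)
  smul_zero r := rfl
  smul_add r f g := rfl
  add_smul r s f := by
    ext x; exact (congrArg f (add_smul (unop r) (unop s) x)).trans (map_add f _ _)
  zero_smul f := by
    ext x; exact (congrArg f (zero_smul R x)).trans (map_zero f)

/-- The character group of a right `R`-module is a left `R`-module via `(r · f)(x) = f (x r)`. -/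
abbrev leftModuleCharacter (M : Type u) [AddCommGroup M] [Module Rᵐᵒᵖ M] :
    Module R (CharacterModule M) where
  smul r f := AddMonoidHom.comp (f : M →+ AddCircle (1 : ℚ))
    (DistribSMul.toAddMonoidHom M (op r))
  one_smul f := by
    ext x; exact congrArg f (one_smul Rᵐᵒᵖ x)
  mul_smul r s f := by
    ext x; exact congrArg f (mul_smul (op s) (op r) x)
  smul_zero r := rfl
  smul_add r f g := rfl
  add_smul r s f := by
    ext x; exact (congrArg f (add_smul (op r) (op s) x)).trans (map_add f _ _)
  zero_smul f := by
    ext x; exact (congrArg f (zero_smul Rᵐᵒᵖ x)).trans (map_zero f)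

/-- The character module `M⁺` of a left `R`-module `M`, as a right `R`-module. -/
def charRight (M : ModuleCat.{u} R) : ModuleCat.{u} Rᵐᵒᵖ :=
  letI := rightModuleCharacter (R := R) M
  ModuleCat.of Rᵐᵒᵖ (CharacterModule M)

/-- The character module `N⁺` of a right `R`-module `N`, as a left `R`-module. -/
def charLeft (N : ModuleCat.{u} Rᵐᵒᵖ) : ModuleCat.{u} R :=
  letI := leftModuleCharacter (R := R) N
  ModuleCat.of R (CharacterModule N)

end Character

end GorensteinSub

/-! The two halves of the Gorenstein conditions are transferred separately, both through the
identification `flip` of `Hom(A, D⁺)` with `Hom(D, A⁺)`.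

Orthogonality: since characters carry a projective presentation of `A` to an injective
copresentation of `A⁺`, `flip` and dimension shifting show that `Ext^i(A, D⁺)` and `Ext^i(D, A⁺)`
vanish together (`extVanish_charLeft_iff`). To reach every `C` in `𝒞`, and not only modules `D⁺`,
pure injectivity is used: `C` embeds purely in `C⁺⁺`, hence is a retract of it
(`IsPureInjective.exists_retraction`), and `C⁺` lies in `𝒟`.

Resolutions: dualizing a proper coresolution of `A` gives a proper resolution of `A⁺`. Conversely, a
proper resolution of `A⁺` need not consist of dual maps, so a coresolution of `A` is built afresh
from preenvelopes. A preenvelope `f : A ⟶ X` is mono because `A` embeds in the dual of a module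
covering `A⁺`. Its dual is a precover of `A⁺` with kernel `(coker f)⁺`. Schanuel's lemma compares
this kernel with the syzygy of the given resolution: they agree up to summands from `𝒟`. Those
summands cannot obviously be cancelled, so the invariant carried through the recursion is the stable
condition `stableResTilde`. -/

namespace GorensteinSub

/-! ### Proper (co)resolutions one step at a time -/

section AbelianCategory

open Limits Abelian

variable {𝒜 : Type u} [Category.{v} 𝒜] [Abelian 𝒜]

/-- If every object of `Q` embeds by a `P`-preenvelope with cokernel in `Q`, then every object
of `Q` has a proper `P`-coresolution. -/
lemma coresTilde_of_preenvelope_step (P Q : ObjectProperty 𝒜)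
    (step : ∀ A, Q A → ∃ (X B : 𝒜) (f : A ⟶ X) (p : X ⟶ B) (h : f ≫ p = 0),
      IsPreenvelope P f ∧ (ShortComplex.mk f p h).ShortExact ∧ Q B) (A : 𝒜) (hA : Q A) :
    coresTilde P A := by
  choose X B f p w hf hS hB using fun s : {A : 𝒜 // Q A} => step s.1 s.2
  let s : ℕ → {A : 𝒜 // Q A} := fun n => Nat.rec ⟨A, hA⟩ (fun _ t => ⟨B t, hB t⟩) n
  have hmono : ∀ t, Mono (f t) := fun t => (hS t).mono_f
  have hepi : ∀ t, Epi (p t) := fun t => (hS t).epi_g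
  have hdesc : ∀ (t) {Y : 𝒜} (g : X t ⟶ Y), f t ≫ g = 0 → ∃ g' : B t ⟶ Y, p t ≫ g' = g :=
    fun t Y g hg => ⟨(hS t).exact.desc g hg, (hS t).exact.g_desc g hg⟩
  let d : ∀ i, X (s i) ⟶ X (s (i + 1)) := fun i => p (s i) ≫ f (s (i + 1))
  have hd : ∀ i, f (s i) ≫ d i = 0 := fun i => by
    simp only [d, ← Category.assoc, w]; exact zero_comp
  have hdd : ∀ i, d i ≫ d (i + 1) = 0 := fun i => by
    have := hd (i + 1)
    change (p (s i) ≫ f (s (i + 1))) ≫ _ = 0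
    rw [Category.assoc, this, comp_zero]
  have hex : ∀ i, (ShortComplex.mk (f (s i)) (d i) (hd i)).Exact := fun i =>
    ShortComplex.exact_of_f_is_kernel _ <| KernelFork.IsLimit.ofι' _ _ fun k hk =>
      ⟨(hS (s i)).exact.lift k (by
        rw [← cancel_mono (f (s (i + 1)))]
        exact (Category.assoc _ _ _).trans (hk.trans zero_comp.symm)),
        (hS (s i)).exact.lift_f _ _⟩
  -- A map killed by `f` descends to the cokernel, and then extends over the next preenvelope. This
  -- one factorization gives all of the `Hom(-, P)`-exactness beyond surjectivity.
  have hfac : ∀ (i) {Y : 𝒜}, P Y → ∀ g : X (s i) ⟶ Y, f (s i) ≫ g = 0 →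
      ∃ g' : X (s (i + 1)) ⟶ Y, d i ≫ g' = g := fun i Y hY g hg => by
    obtain ⟨g₁, rfl⟩ := hdesc (s i) g hg
    obtain ⟨g₂, rfl⟩ := (hf (s (i + 1))).2 Y hY g₁
    exact ⟨g₂, Category.assoc _ _ _⟩
  refine ⟨fun i => X (s i), f (s 0), d, fun i => (hf (s i)).1, ⟨hmono _, ⟨hd 0, hex 0⟩, fun i =>
    ⟨hdd i, ?_⟩⟩, fun Y hY => ⟨(hf (s 0)).2 Y hY, ?_, fun i => ?_⟩⟩
  -- Precomposing with the epimorphism `p (s i)` does not change the image, so exactness reduces to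
  -- `hex`.
  · let φ : ShortComplex.mk (d i) (d (i + 1)) (hdd i) ⟶
        ShortComplex.mk (f (s (i + 1))) (d (i + 1)) (hd (i + 1)) :=
      { τ₁ := p (s i), τ₂ := 𝟙 _, τ₃ := 𝟙 _ }
    have : Epi φ.τ₁ := hepi (s i)
    have : IsIso φ.τ₂ := inferInstanceAs (IsIso (𝟙 _))
    have : Mono φ.τ₃ := inferInstanceAs (Mono (𝟙 _))
    exact (ShortComplex.exact_iff_of_epi_of_isIso_of_mono φ).2 (hex (i + 1))
  · refine fun g => ⟨hfac 0 hY g, ?_⟩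
    rintro ⟨g', rfl⟩
    change f (s 0) ≫ d 0 ≫ g' = 0
    rw [← Category.assoc, hd, zero_comp]
  · refine fun g => ⟨fun hg => hfac (i + 1) hY g ?_, ?_⟩
    · have := hepi (s i)
      rw [← cancel_epi (p (s i))]
      exact ((Category.assoc _ _ _).symm.trans hg).trans comp_zero.symm
    · rintro ⟨g', rfl⟩
      change d i ≫ d (i + 1) ≫ g' = 0
      rw [← Category.assoc, hdd, zero_comp]

/-- The first syzygy is properly resolved by the tail of the resolution, since `kernel.ι ε` is mono
and so does not affect which maps vanish. -/
lemma resTilde.exists_step {P : ObjectProperty 𝒜} {A : 𝒜} (hA : resTilde P A) :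
    ∃ (K X : 𝒜) (k : K ⟶ X) (ε : X ⟶ A) (h : k ≫ ε = 0), P X ∧ resTilde P K ∧
      (ShortComplex.mk k ε h).ShortExact ∧
      ∀ Y : 𝒜, P Y → Function.Surjective (fun g : Y ⟶ X => g ≫ ε) := by
  obtain ⟨X, ε, d, hX, hres, hom⟩ := hA
  obtain ⟨h0, hex0⟩ := hres.exact_zero
  have := hres.epi
  obtain ⟨h1, hex1⟩ := hres.exact_succ 0
  let e : X 1 ⟶ kernel ε := kernel.lift ε (d 0) h0
  have he : e ≫ kernel.ι ε = d 0 := kernel.lift_ι _ _ _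
  have hde : d 1 ≫ e = 0 := by
    rw [← cancel_mono (kernel.ι ε), Category.assoc, he, h1, zero_comp]
  refine ⟨kernel ε, X 0, kernel.ι ε, ε, kernel.condition ε, hX 0,
    ⟨fun i => X (i + 1), e, fun i => d (i + 1), fun i => hX _,
      ⟨?_, ⟨hde, ?_⟩, fun i => hres.exact_succ (i + 1)⟩,
      fun Y hY => ⟨fun g => ?_, fun g => ?_, fun i => (hom Y hY).exact_succ (i + 1)⟩⟩,
      .mk' (ShortComplex.exact_kernel ε) inferInstance inferInstance,
      fun Y hY => (hom Y hY).surjective⟩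
  · exact (ShortComplex.exact_iff_epi_kernel_lift _).1 hex0
  · let φ : ShortComplex.mk (d 1) e hde ⟶ ShortComplex.mk (d 1) (d 0) h1 :=
      { τ₁ := 𝟙 _, τ₂ := 𝟙 _, τ₃ := kernel.ι ε }
    have : Epi φ.τ₁ := inferInstanceAs (Epi (𝟙 _))
    have : IsIso φ.τ₂ := inferInstanceAs (IsIso (𝟙 _))
    have : Mono φ.τ₃ := inferInstanceAs (Mono (kernel.ι ε))
    exact (ShortComplex.exact_iff_of_epi_of_isIso_of_mono φ).2 hex1
  · obtain ⟨g', hg'⟩ := ((hom Y hY).exact_zero (g ≫ kernel.ι ε)).1 (by simp)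
    exact ⟨g', by rw [← cancel_mono (kernel.ι ε)]; simpa [he] using hg'⟩
  · rw [← (hom Y hY).exact_succ 0 g]
    change g ≫ e = 0 ↔ g ≫ d 0 = 0
    rw [← he, ← Category.assoc, ← cancel_mono (kernel.ι ε), zero_comp]

/-! ### Vanishing of Ext by dimension shifting -/

variable [HasExt.{w} 𝒜]

lemma ExtVanish.of_retract {X Y Z : 𝒜} (h : ExtVanish.{w} X Y) (i : Z ⟶ Y) (r : Y ⟶ Z)
    (hir : i ≫ r = 𝟙 Z) : ExtVanish.{w} X Z := fun n hn => by
  have := h n hn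
  have key : ∀ x : Ext.{w} X Z n, x = 0 := fun x => by
    rw [← x.comp_mk₀_id, ← hir, ← Ext.mk₀_comp_mk₀,
      ← Ext.comp_assoc_of_third_deg_zero,
      Subsingleton.elim (x.comp (Ext.mk₀ i) _) 0, Ext.zero_comp]
  exact ⟨fun x y => (key x).trans (key y).symm⟩

/-- In the long exact sequence `Ext¹(S.X₂, Y)` is zero, so `Ext¹(S.X₃, Y)` is the cokernel of
restriction along `S.f`. -/
lemma subsingleton_ext_one_iff_of_projective {S : ShortComplex 𝒜} (hS : S.ShortExact)
    [Projective S.X₂] (Y : 𝒜) : Subsingleton (Ext.{w} S.X₃ Y 1) ↔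
      Function.Surjective (fun g : S.X₂ ⟶ Y => S.f ≫ g) := by
  refine ⟨fun h g => ?_, fun h => ?_⟩
  · obtain ⟨x, hx⟩ := Ext.contravariant_sequence_exact₁ hS Y (Ext.mk₀ g) (add_zero 1)
      (Subsingleton.elim _ _)
    obtain ⟨x, rfl⟩ := (Ext.mk₀_bijective _ _).2 x
    exact ⟨x, (Ext.mk₀_bijective _ _).1 (by simpa using hx)⟩
  · have key : ∀ x : Ext.{w} S.X₃ Y 1, x = 0 := fun x => by
      obtain ⟨y, rfl⟩ := Ext.contravariant_sequence_exact₃ hS Y x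
        (Ext.eq_zero_of_projective _) (add_zero 1)
      obtain ⟨y, rfl⟩ := (Ext.mk₀_bijective _ _).2 y
      obtain ⟨z, rfl⟩ := h y
      simp only
      rw [← Ext.mk₀_comp_mk₀, ← Ext.comp_assoc_of_third_deg_zero]
      simp
    exact ⟨fun x y => (key x).trans (key y).symm⟩

lemma subsingleton_ext_one_iff_of_injective {S : ShortComplex 𝒜} (hS : S.ShortExact)
    [Injective S.X₂] (Y : 𝒜) : Subsingleton (Ext.{w} Y S.X₁ 1) ↔
      Function.Surjective (fun g : Y ⟶ S.X₂ => g ≫ S.g) := by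
  refine ⟨fun h g => ?_, fun h => ?_⟩
  · obtain ⟨x, hx⟩ := Ext.covariant_sequence_exact₃ Y hS (Ext.mk₀ g) (zero_add 1)
      (Subsingleton.elim _ _)
    obtain ⟨x, rfl⟩ := (Ext.mk₀_bijective _ _).2 x
    exact ⟨x, (Ext.mk₀_bijective _ _).1 (by simpa using hx)⟩
  · have key : ∀ x : Ext.{w} Y S.X₁ 1, x = 0 := fun x => by
      obtain ⟨y, rfl⟩ := Ext.covariant_sequence_exact₁ Y hS x
        (Ext.eq_zero_of_injective _) (zero_add 1)
      obtain ⟨y, rfl⟩ := (Ext.mk₀_bijective _ _).2 y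
      obtain ⟨z, rfl⟩ := h y
      simp only
      rw [← Ext.mk₀_comp_mk₀, Ext.comp_assoc_of_second_deg_zero]
      simp
    exact ⟨fun x y => (key x).trans (key y).symm⟩

lemma subsingleton_ext_succ_iff_of_projective {S : ShortComplex 𝒜} (hS : S.ShortExact)
    [Projective S.X₂] (Y : 𝒜) (n : ℕ) : Subsingleton (Ext.{w} S.X₃ Y (n + 2)) ↔
      Subsingleton (Ext.{w} S.X₁ Y (n + 1)) := by
  refine ⟨fun h => ⟨fun x y => ?_⟩, fun h => ⟨fun x y => ?_⟩⟩
  · obtain ⟨z, hz⟩ := Ext.contravariant_sequence_exact₁ hS Y (x - y) (by omega : 1 + (n + 1) = n + 2)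
      (Subsingleton.elim _ _)
    rw [Ext.eq_zero_of_projective z, Ext.comp_zero] at hz
    exact sub_eq_zero.1 hz.symm
  · obtain ⟨z, hz⟩ := Ext.contravariant_sequence_exact₃ hS Y (x - y)
      (Ext.eq_zero_of_projective _) (by omega : 1 + (n + 1) = n + 2)
    rw [Subsingleton.elim z 0, Ext.comp_zero] at hz
    exact sub_eq_zero.1 hz.symm

lemma subsingleton_ext_succ_iff_of_injective {S : ShortComplex 𝒜} (hS : S.ShortExact)
    [Injective S.X₂] (Y : 𝒜) (n : ℕ) : Subsingleton (Ext.{w} Y S.X₁ (n + 2)) ↔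
      Subsingleton (Ext.{w} Y S.X₃ (n + 1)) := by
  refine ⟨fun h => ⟨fun x y => ?_⟩, fun h => ⟨fun x y => ?_⟩⟩
  · obtain ⟨z, hz⟩ := Ext.covariant_sequence_exact₃ Y hS (x - y) (rfl : (n + 1) + 1 = n + 2)
      (Subsingleton.elim _ _)
    rw [Ext.eq_zero_of_injective z, Ext.zero_comp] at hz
    exact sub_eq_zero.1 hz.symm
  · obtain ⟨z, hz⟩ := Ext.covariant_sequence_exact₁ Y hS (x - y)
      (Ext.eq_zero_of_injective _) (rfl : (n + 1) + 1 = n + 2)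
    rw [Subsingleton.elim z 0, Ext.zero_comp] at hz
    exact sub_eq_zero.1 hz.symm

end AbelianCategory

/-! ### Character duality, on Hom and on Ext -/

section Character

variable {R : Type u} [Ring R]

/-- An element of `M⁺`, for `M` a left module, as an additive character. -/
def charRightEquiv (M : ModuleCat.{u} R) : charRight M ≃+ (M →+ AddCircle (1 : ℚ)) :=
  AddEquiv.refl _

/-- An element of `N⁺`, for `N` a right module, as an additive character. -/
def charLeftEquiv (N : ModuleCat.{u} Rᵐᵒᵖ) : charLeft N ≃+ (N →+ AddCircle (1 : ℚ)) :=
  AddEquiv.refl _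

@[simp]
lemma charRightEquiv_smul (M : ModuleCat.{u} R) (r : Rᵐᵒᵖ) (φ : charRight M) (x : M) :
    charRightEquiv M (r • φ) x = charRightEquiv M φ (unop r • x) := rfl

@[simp]
lemma charLeftEquiv_smul (N : ModuleCat.{u} Rᵐᵒᵖ) (r : R) (φ : charLeft N) (x : N) :
    charLeftEquiv N (r • φ) x = charLeftEquiv N φ (op r • x) := rfl

lemma charRight_ext {M : ModuleCat.{u} R} {φ ψ : charRight M}
    (h : ∀ x, charRightEquiv M φ x = charRightEquiv M ψ x) : φ = ψ :=
  (charRightEquiv M).injective (AddMonoidHom.ext h)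

lemma charLeft_ext {N : ModuleCat.{u} Rᵐᵒᵖ} {φ ψ : charLeft N}
    (h : ∀ x, charLeftEquiv N φ x = charLeftEquiv N ψ x) : φ = ψ :=
  (charLeftEquiv N).injective (AddMonoidHom.ext h)

/-- The map `g⁺ : N⁺ ⟶ M⁺` induced by a map `g : M ⟶ N` of left modules. -/
def charRightMap {M N : ModuleCat.{u} R} (g : M ⟶ N) : charRight N ⟶ charRight M :=
  ModuleCat.ofHom (X := charRight N) (Y := charRight M)
    { toFun φ := (charRightEquiv M).symm ((charRightEquiv N φ).comp g.hom.toAddMonoidHom)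
      map_add' _ _ := rfl
      map_smul' r φ := charRight_ext fun x =>
        congrArg (charRightEquiv N φ) (g.hom.map_smul (unop r) x).symm }

@[simp]
lemma charRightMap_apply {M N : ModuleCat.{u} R} (g : M ⟶ N) (φ : charRight N) (x : M) :
    charRightEquiv M ((charRightMap g).hom φ) x = charRightEquiv N φ (g.hom x) := rfl

/-- `Hom(A, D⁺)` and `Hom(D, A⁺)` both consist of the balanced pairings of `D` and `A`. -/
def flip (A : ModuleCat.{u} R) (D : ModuleCat.{u} Rᵐᵒᵖ) :
    (A ⟶ charLeft D) ≃ (D ⟶ charRight A) where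
  toFun g := ModuleCat.ofHom (X := D) (Y := charRight A)
    { toFun d := (charRightEquiv A).symm
        { toFun a := charLeftEquiv D (g.hom a) d
          map_zero' := by simp
          map_add' _ _ := by simp }
      map_add' _ _ := charRight_ext fun a => map_add (charLeftEquiv D (g.hom a)) _ _
      map_smul' r d := charRight_ext fun a =>
        (congrArg (fun φ => charLeftEquiv D φ d) (g.hom.map_smul (unop r) a)).symm }
  invFun g := ModuleCat.ofHom (X := A) (Y := charLeft D)
    { toFun a := (charLeftEquiv D).symm
        { toFun d := charRightEquiv A (g.hom d) a
          map_zero' := by simp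
          map_add' _ _ := by simp }
      map_add' _ _ := charLeft_ext fun d => map_add (charRightEquiv A (g.hom d)) _ _
      map_smul' r a := charLeft_ext fun d =>
        (congrArg (fun φ => charRightEquiv A φ a) (g.hom.map_smul (op r) d)).symm }
  left_inv _ := rfl
  right_inv _ := rfl

@[simp]
lemma flip_apply {A : ModuleCat.{u} R} {D : ModuleCat.{u} Rᵐᵒᵖ} (g : A ⟶ charLeft D) (d : D)
    (a : A) : charRightEquiv A ((flip A D g).hom d) a = charLeftEquiv D (g.hom a) d := rfl

@[simp]
lemma flip_symm_apply {A : ModuleCat.{u} R} {D : ModuleCat.{u} Rᵐᵒᵖ} (g : D ⟶ charRight A) (d : D)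
    (a : A) : charLeftEquiv D (((flip A D).symm g).hom a) d = charRightEquiv A (g.hom d) a := rfl

lemma flip_comp {A B : ModuleCat.{u} R} {D : ModuleCat.{u} Rᵐᵒᵖ} (f : A ⟶ B)
    (g : B ⟶ charLeft D) : flip A D (f ≫ g) = flip B D g ≫ charRightMap f := rfl

lemma flip_zero (A : ModuleCat.{u} R) (D : ModuleCat.{u} Rᵐᵒᵖ) : flip A D 0 = 0 := rfl

/-- Naturality of `flip`; this is what turns preenvelopes into precovers. -/
lemma surjective_comp_iff {A B : ModuleCat.{u} R} (f : A ⟶ B) (D : ModuleCat.{u} Rᵐᵒᵖ) :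
    Function.Surjective (fun g : B ⟶ charLeft D => f ≫ g) ↔
      Function.Surjective (fun g : D ⟶ charRight B => g ≫ charRightMap f) := by
  rw [← (flip A D).comp_surjective, ← (flip B D).surjective_comp]
  rfl

lemma exact_comp_iff {A B C : ModuleCat.{u} R} (f : A ⟶ B) (f' : B ⟶ C)
    (D : ModuleCat.{u} Rᵐᵒᵖ) :
    Function.Exact (fun g : C ⟶ charLeft D => f' ≫ g) (fun g : B ⟶ charLeft D => f ≫ g) ↔
      Function.Exact (fun g : D ⟶ charRight C => g ≫ charRightMap f')
        (fun g : D ⟶ charRight B => g ≫ charRightMap f) := by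
  refine (flip B D).forall_congr fun g => ?_
  refine iff_congr ?_ ?_
  · simp only [← flip_comp, ← flip_zero, (flip A D).apply_eq_iff_eq]
  · simp only [Set.mem_range]
    rw [← (flip C D).exists_congr_right]
    simp only [← flip_comp, (flip B D).apply_eq_iff_eq]

/-- Characters extend along injective maps. -/
lemma exists_character_extension {M N : Type*} [AddCommGroup M] [AddCommGroup N] (f : M →+ N)
    (hf : Function.Injective f) (φ : M →+ AddCircle (1 : ℚ)) :
    ∃ ψ : N →+ AddCircle (1 : ℚ), ψ.comp f = φ := by
  obtain ⟨ψ, hψ⟩ := CharacterModule.dual_surjective_of_injective f.toIntLinearMap hf φ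
  exact ⟨ψ, hψ⟩

lemma exists_character_ne_zero {M : Type*} [AddCommGroup M] {x : M} (hx : x ≠ 0) :
    ∃ φ : M →+ AddCircle (1 : ℚ), φ x ≠ 0 :=
  CharacterModule.exists_character_apply_ne_zero_of_ne_zero hx

/-- The character functor is exact. -/
lemma exists_character_factor {M N P : Type*} [AddCommGroup M] [AddCommGroup N] [AddCommGroup P]
    (f : M →+ N) (g : N →+ P) (h : Function.Exact f g) (φ : N →+ AddCircle (1 : ℚ))
    (hφ : φ.comp f = 0) : ∃ ψ : P →+ AddCircle (1 : ℚ), ψ.comp g = φ := by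
  have hk : g.ker ≤ φ.ker := fun x hx => by
    obtain ⟨y, rfl⟩ := (h x).1 hx
    exact DFunLike.congr_fun hφ y
  obtain ⟨ψ, hψ⟩ := exists_character_extension (QuotientAddGroup.kerLift g)
    (QuotientAddGroup.kerLift_injective g) (QuotientAddGroup.lift g.ker φ hk)
  refine ⟨ψ, AddMonoidHom.ext fun x => ?_⟩
  exact DFunLike.congr_fun hψ (QuotientAddGroup.mk x)

lemma charRightMap_surjective {M N : ModuleCat.{u} R} (f : M ⟶ N)
    (hf : Function.Injective f.hom) : Function.Surjective (charRightMap f).hom := fun φ =>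
  exists_character_extension f.hom.toAddMonoidHom hf φ

lemma charRightMap_injective {M N : ModuleCat.{u} R} (f : M ⟶ N)
    (hf : Function.Surjective f.hom) : Function.Injective (charRightMap f).hom :=
  fun φ ψ h => charRight_ext fun x => by
    obtain ⟨y, rfl⟩ := hf x
    exact congrArg (fun χ => charRightEquiv M χ y) h

lemma charRightMap_exact {M N P : ModuleCat.{u} R} (f : M ⟶ N) (g : N ⟶ P)
    (h : Function.Exact f.hom g.hom) :
    Function.Exact (charRightMap g).hom (charRightMap f).hom := fun φ => by
  refine ⟨fun hφ => exists_character_factor f.hom.toAddMonoidHom g.hom.toAddMonoidHom h φ hφ, ?_⟩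
  rintro ⟨ψ, rfl⟩
  refine charRight_ext fun x => ?_
  simp [h.apply_apply_eq_zero]

lemma charRightMap_comp {M N P : ModuleCat.{u} R} (f : M ⟶ N) (g : N ⟶ P) :
    charRightMap (f ≫ g) = charRightMap g ≫ charRightMap f := rfl

lemma charRightMap_zero (M N : ModuleCat.{u} R) : charRightMap (0 : M ⟶ N) = 0 := by
  ext φ
  exact charRight_ext fun x => map_zero (charRightEquiv N φ)

/-- The short complex of character modules. -/
def charRightShortComplex (S : ShortComplex (ModuleCat.{u} R)) :
    ShortComplex (ModuleCat.{u} Rᵐᵒᵖ) :=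
  .mk (charRightMap S.g) (charRightMap S.f) (by
    rw [← charRightMap_comp, S.zero, charRightMap_zero])

lemma charRightShortComplex_exact {S : ShortComplex (ModuleCat.{u} R)} (hS : S.Exact) :
    (charRightShortComplex S).Exact :=
  (ShortComplex.ShortExact.moduleCat_exact_iff_function_exact _).2
    (charRightMap_exact _ _ ((ShortComplex.ShortExact.moduleCat_exact_iff_function_exact _).1 hS))

lemma charRightShortComplex_shortExact {S : ShortComplex (ModuleCat.{u} R)} (hS : S.ShortExact) :
    (charRightShortComplex S).ShortExact :=
  .mk' (charRightShortComplex_exact hS.exact)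
    ((ModuleCat.mono_iff_injective _).2 (charRightMap_injective _ hS.moduleCat_surjective_g))
    ((ModuleCat.epi_iff_surjective _).2 (charRightMap_surjective _ hS.moduleCat_injective_f))

/-- Characters of a projective module form an injective module. -/
lemma injective_charRight (P : ModuleCat.{u} R) [Projective P] : Injective (charRight P) where
  factors {X Y} g f hf := by
    let i : charLeft Y ⟶ charLeft X := ModuleCat.ofHom (X := charLeft Y) (Y := charLeft X)
      { toFun φ := (charLeftEquiv X).symm ((charLeftEquiv Y φ).comp f.hom.toAddMonoidHom)
        map_add' _ _ := rfl
        map_smul' r φ := charLeft_ext fun x =>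
          congrArg (charLeftEquiv Y φ) (f.hom.map_smul (op r) x).symm }
    have : Epi i := (ModuleCat.epi_iff_surjective _).2 fun φ =>
      exists_character_extension f.hom.toAddMonoidHom ((ModuleCat.mono_iff_injective _).1 hf) φ
    -- Under `flip`, extending `g` along the mono `f` becomes lifting a map from `P` along the epi
    -- `f⁺`.
    refine ⟨flip P Y (Projective.factorThru ((flip P X).symm g) i), ?_⟩
    ext x
    refine charRight_ext fun a => ?_
    have := congrArg (fun h : P ⟶ charLeft X => charLeftEquiv X (h.hom a) x)
      (Projective.factorThru_comp ((flip P X).symm g) i)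
    exact this

/-- Degree one is a lifting condition on each side, and `flip` matches the two. Higher degrees shift
to the syzygy of `A`, whose dual is the cosyzygy of `A⁺`; hence the induction must vary `A`. -/
lemma subsingleton_ext_charLeft_iff (D : ModuleCat.{u} Rᵐᵒᵖ) (n : ℕ) (A : ModuleCat.{u} R) :
    Subsingleton (Abelian.Ext.{u} A (charLeft D) (n + 1)) ↔
      Subsingleton (Abelian.Ext.{u} D (charRight A) (n + 1)) := by
  have hS := A.shortExact_projectiveShortComplex
  have : Projective A.projectiveShortComplex.X₂ := inferInstance
  have hS' := charRightShortComplex_shortExact hS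
  have : Injective (charRightShortComplex A.projectiveShortComplex).X₂ := injective_charRight _
  induction n generalizing A with
  | zero =>
    exact (subsingleton_ext_one_iff_of_projective hS _).trans <| (surjective_comp_iff _ _).trans
      (subsingleton_ext_one_iff_of_injective hS' _).symm
  | succ n ih =>
    exact (subsingleton_ext_succ_iff_of_projective hS _ n).trans <|
      (ih _ (ModuleCat.shortExact_projectiveShortComplex _) inferInstance
        (charRightShortComplex_shortExact (ModuleCat.shortExact_projectiveShortComplex _))
        (injective_charRight _)).trans
      (subsingleton_ext_succ_iff_of_injective hS' _ n).symm

lemma extVanish_charLeft_iff (A : ModuleCat.{u} R) (D : ModuleCat.{u} Rᵐᵒᵖ) :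
    ExtVanish.{u} A (charLeft D) ↔ ExtVanish.{u} D (charRight A) := by
  refine forall_congr' fun n => forall_congr' fun hn => ?_
  obtain ⟨n, rfl⟩ := Nat.exists_eq_add_of_le' hn
  exact subsingleton_ext_charLeft_iff D n A

end Character

/-! ### Purity of the embedding into the double dual -/

section Pure

variable {R : Type u} [Ring R]

/-- A short exact sequence is pure if every finite system of linear equations over the submodule
that is solvable in the ambient module is solvable in the submodule. -/
lemma isPureExact_of_solvable {S : ShortComplex (ModuleCat.{u} R)} (hS : S.ShortExact)
    (solve : ∀ (m n : ℕ) (r : Fin m → Fin n → R) (c : Fin m → S.X₁) (q : Fin n → S.X₂),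
      (∀ i, ∑ j, r i j • q j = S.f.hom (c i)) →
      ∃ x : Fin n → S.X₁, ∀ i, ∑ j, r i j • x j = c i) : IsPureExact S := by
  refine ⟨hS, fun M hM => ⟨fun a b hab => ?_, fun h => ⟨fun hh => ?_, ?_⟩, fun h => ?_⟩⟩
  · have := hS.mono_f
    exact (cancel_mono S.f).1 hab
  · have := hS.mono_f
    exact ⟨hS.exact.lift h hh, hS.exact.lift_f h hh⟩
  · rintro ⟨k, rfl⟩
    simp
  · obtain ⟨n, m, f, g, hf, hfg⟩ := Module.FinitePresentation.exists_fin' R M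
    have hex := (ShortComplex.ShortExact.moduleCat_exact_iff_function_exact _).1 hS.exact
    choose q hq using fun j => hS.moduleCat_surjective_g (h.hom (f (Pi.single j 1)))
    have hlin : ∀ v : Fin n → R, S.g.hom (∑ j, v j • q j) = h.hom (f v) := fun v => by
      conv_rhs => rw [pi_eq_sum_univ' v]
      simp only [map_sum, map_smul]
      exact Finset.sum_congr rfl fun j _ => congrArg (v j • ·) (hq j)
    choose c hc using fun i => (hex (∑ j, g (Pi.single i 1) j • q j)).1
      ((hlin _).trans (by rw [hfg.apply_apply_eq_zero, map_zero]))
    obtain ⟨x, hx⟩ := solve m n (fun i => g (Pi.single i 1)) c q fun i => (hc i).symm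
    -- The lifts `q j` satisfy the relations of `M` only up to the errors `c i`. Subtracting a
    -- solution `x` in the submodule removes these errors without changing the image in `S.X₃`.
    let l : (Fin n → R) →ₗ[R] S.X₂ := Fintype.linearCombination R fun j => q j - S.f.hom (x j)
    have hl : ∀ v, l v = ∑ j, v j • q j - S.f.hom (∑ j, v j • x j) := fun v => by
      simp [l, Fintype.linearCombination_apply, smul_sub]
    have hlg : l ∘ₗ g = 0 := by
      refine LinearMap.pi_ext' fun i => LinearMap.ext_ring ?_
      change l (g (Pi.single i 1)) = 0
      rw [hl, hx, hc, sub_self]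
    have hker : LinearMap.ker f ≤ LinearMap.ker l := fun v hv => by
      obtain ⟨w, rfl⟩ := (hfg v).1 hv
      exact LinearMap.congr_fun hlg w
    refine ⟨ModuleCat.ofHom ((LinearMap.ker f).liftQ l hker ∘ₗ
      (f.quotKerEquivOfSurjective hf).symm.toLinearMap), ?_⟩
    ext y
    obtain ⟨v, rfl⟩ := hf y
    have hv : (f.quotKerEquivOfSurjective hf).symm (f v) = (LinearMap.ker f).mkQ v :=
      (LinearEquiv.symm_apply_eq _).2 rfl
    change S.g.hom ((LinearMap.ker f).liftQ l hker ((f.quotKerEquivOfSurjective hf).symm (f v))) = _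
    rw [hv, Submodule.mkQ_apply, Submodule.liftQ_apply, hl, map_sub, hlin, sub_eq_self]
    exact (hex _).2 ⟨_, rfl⟩

/-- The evaluation map from a module into its double character module. -/
def evaluation (C : ModuleCat.{u} R) : C ⟶ charLeft (charRight C) :=
  (flip C (charRight C)).symm (𝟙 _)

@[simp]
lemma evaluation_apply {C : ModuleCat.{u} R} (x : C) (φ : charRight C) :
    charLeftEquiv _ ((evaluation C).hom x) φ = charRightEquiv C φ x := rfl

lemma evaluation_injective (C : ModuleCat.{u} R) : Function.Injective (evaluation C).hom := by
  refine (injective_iff_map_eq_zero _).2 fun x hx => by_contra fun h => ?_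
  obtain ⟨φ, hφ⟩ := exists_character_ne_zero h
  refine hφ ?_
  rw [← charRightEquiv C |>.apply_symm_apply φ, ← evaluation_apply, hx]
  simp

/-- If `c` were outside the image of the matrix, a character of `C^m` would vanish on that image but
not at `c`. Its components `ψ i` satisfy the transposed homogeneous system, and pairing them with
the solution `q` in `C⁺⁺` forces the value at `c` to be zero. -/
lemma exists_solution_of_charLeft_charRight {C : ModuleCat.{u} R} {m n : ℕ}
    (r : Fin m → Fin n → R) (c : Fin m → C) (q : Fin n → charLeft (charRight C))
    (h : ∀ i, ∑ j, r i j • q j = (evaluation C).hom (c i)) :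
    ∃ x : Fin n → C, ∀ i, ∑ j, r i j • x j = c i := by
  -- Only additive: over a noncommutative ring, multiplying by a matrix of scalars on the left is
  -- not `R`-linear.
  let T : (Fin n → C) →+ (Fin m → C) :=
    { toFun x i := ∑ j, r i j • x j
      map_zero' := by ext; simp
      map_add' _ _ := by ext; simp [Finset.sum_add_distrib] }
  suffices c ∈ T.range from this.imp fun x hx => congrFun hx
  by_contra hT
  obtain ⟨φ, hφ⟩ := exists_character_ne_zero
    (mt (QuotientAddGroup.eq_zero_iff (N := T.range) c).1 hT)
  let φ' := φ.comp (QuotientAddGroup.mk' T.range)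
  let ψ : Fin m → charRight C := fun i =>
    (charRightEquiv C).symm (φ'.comp (AddMonoidHom.single (fun _ => C) i))
  have hψ : ∀ y : Fin m → C, ∑ i, charRightEquiv C (ψ i) (y i) = φ' y := fun y => by
    conv_rhs => rw [← Finset.univ_sum_single y, map_sum]
    rfl
  have hrel : ∀ j, ∑ i, op (r i j) • ψ i = 0 := fun j => charRight_ext fun x => by
    have h1 : φ' (T (Pi.single j x)) = 0 := by
      have : (QuotientAddGroup.mk' T.range) (T (Pi.single j x)) = 0 :=
        (QuotientAddGroup.eq_zero_iff _).2 ⟨_, rfl⟩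
      change φ _ = 0
      rw [this, map_zero]
    rw [← hψ] at h1
    simp only [map_sum, map_zero, AddMonoidHom.finsetSum_apply, charRightEquiv_smul, unop_op,
      AddMonoidHom.zero_apply]
    refine Eq.trans (Finset.sum_congr rfl fun i _ => ?_) h1
    congr 1
    simp [T, Pi.single_apply]
  refine hφ ?_
  change φ' c = 0
  rw [← hψ]
  calc ∑ i, charRightEquiv C (ψ i) (c i)
      = ∑ i, ∑ j, charLeftEquiv _ (q j) (op (r i j) • ψ i) := Finset.sum_congr rfl fun i _ => by
        rw [← evaluation_apply, ← h i]
        simp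
    _ = ∑ j, charLeftEquiv _ (q j) (∑ i, op (r i j) • ψ i) := by
        rw [Finset.sum_comm]
        simp
    _ = 0 := by simp [hrel]

/-- A pure injective module is a direct summand of its double character module. -/
lemma IsPureInjective.exists_retraction {C : ModuleCat.{u} R} (hC : IsPureInjective C) :
    ∃ ρ : charLeft (charRight C) ⟶ C, evaluation C ≫ ρ = 𝟙 C := by
  have : Mono (evaluation C) := (ModuleCat.mono_iff_injective _).2 (evaluation_injective C)
  have hS : (ShortComplex.mk (evaluation C) (Limits.cokernel.π (evaluation C))
      (Limits.cokernel.condition _)).ShortExact :=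
    .mk' (ShortComplex.exact_cokernel _) inferInstance inferInstance
  exact (hC _ (isPureExact_of_solvable hS fun _ _ r c q h =>
    exists_solution_of_charLeft_charRight r c q h)).2.2 (𝟙 C)

end Pure

/-! ### Schanuel's lemma without projectivity -/

section Schanuel

variable {R : Type u} [Ring R]

lemma prop_prod_of_isClosedUnderFiniteProducts (P : ObjectProperty (ModuleCat.{u} R))
    [P.IsClosedUnderIsomorphisms] [P.IsClosedUnderFiniteProducts] {X Y : ModuleCat.{u} R}
    (hX : P X) (hY : P Y) : P (ModuleCat.of R (X × Y)) :=
  P.prop_of_iso ((Limits.biprod.isoProd X Y).symm ≪≫ ModuleCat.biprodIsoProd X Y)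
    (P.prop_prod X Y hX hY)

variable {K L X Y E : Type*} [AddCommGroup K] [AddCommGroup L] [AddCommGroup X]
  [AddCommGroup Y] [AddCommGroup E] [Module R K] [Module R L] [Module R X] [Module R Y]
  [Module R E]

/-- Schanuel's lemma, for two maps onto the same module which factor through each other. -/
lemma nonempty_kernel_prod_equiv {k : K →ₗ[R] X} {p : X →ₗ[R] E} {l : L →ₗ[R] Y} {q : Y →ₗ[R] E}
    (hk : Function.Injective k) (hkp : Function.Exact k p) (hl : Function.Injective l)
    (hlq : Function.Exact l q) (a : X →ₗ[R] Y) (b : Y →ₗ[R] X) (ha : q ∘ₗ a = p)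
    (hb : p ∘ₗ b = q) : Nonempty ((K × Y) ≃ₗ[R] (L × X)) := by
  replace ha : ∀ x, q (a x) = p x := LinearMap.congr_fun ha
  replace hb : ∀ y, p (b y) = q y := LinearMap.congr_fun hb
  -- Both products are the pullback of `p` and `q`: `b` splits its projection to `Y` and `a` its
  -- projection to `X`. `F` and `G` give the missing coordinate.
  let F : K × Y →ₗ[R] X := k.coprod b
  let G : L × X →ₗ[R] Y := l.coprod a
  have hF : ∀ z : K × Y, z.2 - a (F z) ∈ LinearMap.range l := fun z => (hlq _).1 (by
    simp [F, ha, hb, hkp.apply_apply_eq_zero])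
  have hG : ∀ z : L × X, z.2 - b (G z) ∈ LinearMap.range k := fun z => (hkp _).1 (by
    simp [G, ha, hb, hlq.apply_apply_eq_zero])
  let el := LinearEquiv.ofInjective l hl
  let ek := LinearEquiv.ofInjective k hk
  have hel : ∀ t, l (el.symm t) = t := fun t => congrArg Subtype.val (el.apply_symm_apply t)
  have hek : ∀ t, k (ek.symm t) = t := fun t => congrArg Subtype.val (ek.apply_symm_apply t)
  let Φ : K × Y →ₗ[R] L × X := LinearMap.prod
    (el.symm.toLinearMap ∘ₗ (LinearMap.snd R K Y - a ∘ₗ F).codRestrict _ hF) F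
  let Ψ : L × X →ₗ[R] K × Y := LinearMap.prod
    (ek.symm.toLinearMap ∘ₗ (LinearMap.snd R L X - b ∘ₗ G).codRestrict _ hG) G
  have hΦ : ∀ z, l (Φ z).1 = z.2 - a (F z) := fun z => hel _
  have hΨ : ∀ z, k (Ψ z).1 = z.2 - b (G z) := fun z => hek _
  have hGΦ : ∀ z, G (Φ z) = z.2 := fun z => by
    change l (Φ z).1 + a (F z) = z.2
    rw [hΦ, sub_add_cancel]
  have hFΨ : ∀ z, F (Ψ z) = z.2 := fun z => by
    change k (Ψ z).1 + b (G z) = z.2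
    rw [hΨ, sub_add_cancel]
  refine ⟨LinearEquiv.ofLinearMap Φ Ψ (LinearMap.ext fun z => Prod.ext (hl ?_) (hFΨ z))
    (LinearMap.ext fun z => Prod.ext (hk ?_) (hGΦ z))⟩
  · change l (Φ (Ψ z)).1 = l z.1
    rw [hΦ, hFΨ]
    exact sub_eq_of_eq_add rfl
  · change k (Ψ (Φ z)).1 = k z.1
    rw [hΨ, hGΦ]
    exact sub_eq_of_eq_add rfl

end Schanuel

/-! ### Proper resolutions up to summands -/

section Stable

variable {R : Type u} [Ring R]

/-- The class of all `M` which become isomorphic to a module with a proper `P`-resolution after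
adding modules in `P` on both sides. -/
def stableResTilde (P : ObjectProperty (ModuleCat.{u} R)) : ObjectProperty (ModuleCat.{u} R) :=
  fun M => ∃ N D D' : ModuleCat.{u} R, resTilde P N ∧ P D ∧ P D' ∧
    Nonempty ((M × D) ≃ₗ[R] (N × D'))

lemma resTilde.stableResTilde {P : ObjectProperty (ModuleCat.{u} R)} {M : ModuleCat.{u} R}
    (hM : resTilde P M) : stableResTilde P M := by
  obtain ⟨X, _, _, hX, _⟩ := id hM
  exact ⟨M, X 0, X 0, hM, hX 0, hX 0, ⟨LinearEquiv.refl _ _⟩⟩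

variable {P : ObjectProperty (ModuleCat.{u} R)}
  [P.IsClosedUnderIsomorphisms] [P.IsClosedUnderFiniteProducts]

/-- A module stably having a proper resolution admits a surjection `p` from an object of `P` onto
the sum with an object `D` of `P`; here `K` is its kernel. -/
lemma stableResTilde.exists_step {M : ModuleCat.{u} R} (hM : stableResTilde P M) :
    ∃ (K X D : ModuleCat.{u} R) (k : K →ₗ[R] X) (p : X →ₗ[R] (M × D)), resTilde P K ∧ P X ∧ P D ∧
      Function.Injective k ∧ Function.Exact k p ∧ Function.Surjective p ∧
      ∀ Y : ModuleCat.{u} R, P Y → ∀ g : Y →ₗ[R] (M × D), ∃ g' : Y →ₗ[R] X, p ∘ₗ g' = g := by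
  obtain ⟨N, D, D', hN, hD, hD', ⟨e⟩⟩ := hM
  obtain ⟨K, X, k, ε, h, hX, hK, hS, hε⟩ := hN.exists_step
  have hex := (ShortComplex.ShortExact.moduleCat_exact_iff_function_exact _).1 hS.exact
  -- The precover of `N`, enlarged by the identity of `D'` so as to keep its kernel, is transported
  -- along `e.symm` to `M × D`.
  refine ⟨K, ModuleCat.of R (X × D'), D, LinearMap.inl R X D' ∘ₗ k.hom,
    e.symm.toLinearMap ∘ₗ ε.hom.prodMap LinearMap.id, hK,
    prop_prod_of_isClosedUnderFiniteProducts P hX hD', hD,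
    LinearMap.inl_injective.comp hS.moduleCat_injective_f, ?_, ?_, fun Y hY g => ?_⟩
  · rintro ⟨x, d⟩
    constructor
    · intro hz
      obtain ⟨hx, rfl⟩ := Prod.ext_iff.1 (e.symm.map_eq_zero_iff.1 hz)
      obtain ⟨y, rfl⟩ := (hex x).1 hx
      exact ⟨y, rfl⟩
    · rintro ⟨y, hy⟩
      obtain ⟨rfl, rfl⟩ := Prod.ext_iff.1 hy
      refine e.symm.map_eq_zero_iff.2 (Prod.ext ((hex _).2 ⟨y, rfl⟩) rfl)
  · exact e.symm.surjective.comp (hS.moduleCat_surjective_g.prodMap Function.surjective_id)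
  · obtain ⟨g', hg'⟩ := hε Y hY (ModuleCat.ofHom (LinearMap.fst R N D' ∘ₗ e.toLinearMap ∘ₗ g))
    refine ⟨g'.hom.prod (LinearMap.snd R N D' ∘ₗ e.toLinearMap ∘ₗ g), LinearMap.ext fun y => ?_⟩
    refine (LinearEquiv.symm_apply_eq e).2 (Prod.ext ?_ rfl)
    exact congrArg (fun f : Y ⟶ N => f.hom y) hg'

/-- The kernel of a precover of a module that stably has a proper resolution again stably has
one. -/
lemma stableResTilde.kernel_of_precover {S : ShortComplex (ModuleCat.{u} R)} (hS : S.ShortExact)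
    (hX : P S.X₂)
    (hpre : ∀ Y : ModuleCat.{u} R, P Y → Function.Surjective (fun g : Y ⟶ S.X₂ => g ≫ S.g))
    (h : stableResTilde P S.X₃) : stableResTilde P S.X₁ := by
  obtain ⟨K, X, D, k, p, hK, hX', hD, hk, hkp, hp, hpre'⟩ := h.exists_step
  have hex := (ShortComplex.ShortExact.moduleCat_exact_iff_function_exact _).1 hS.exact
  have hXD := prop_prod_of_isClosedUnderFiniteProducts P hX hD
  -- Two precovers of `S.X₃ × D` factor through each other, which replaces projectivity in
  -- Schanuel's lemma.
  obtain ⟨a, ha⟩ := hpre' _ hXD (S.g.hom.prodMap LinearMap.id)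
  obtain ⟨b, hb⟩ := hpre _ hX' (ModuleCat.ofHom (LinearMap.fst R _ _ ∘ₗ p))
  refine ⟨K, X, ModuleCat.of R (S.X₂ × D), hK, hX', hXD,
    nonempty_kernel_prod_equiv (k := LinearMap.inl R S.X₂ D ∘ₗ S.f.hom)
      (LinearMap.inl_injective.comp hS.moduleCat_injective_f) ?_ hk hkp a
      (b.hom.prod (LinearMap.snd R _ _ ∘ₗ p)) ha (LinearMap.ext fun x => Prod.ext ?_ rfl)⟩
  · rintro ⟨x, d⟩
    constructor
    · intro hz
      obtain ⟨hx, rfl⟩ := Prod.ext_iff.1 hz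
      obtain ⟨y, rfl⟩ := (hex x).1 hx
      exact ⟨y, rfl⟩
    · rintro ⟨y, hy⟩
      obtain ⟨rfl, rfl⟩ := Prod.ext_iff.1 hy
      exact Prod.ext ((hex _).2 ⟨y, rfl⟩) rfl
  · exact congrArg (fun f : X ⟶ S.X₃ => f.hom x) hb

end Stable

/-! ### Transfer of resolutions between `A` and `A⁺` -/

section Main

variable {R : Type u} [Ring R]

lemma resTilde_charRight {𝒞 : ObjectProperty (ModuleCat.{u} R)}
    {𝒟 : ObjectProperty (ModuleCat.{u} Rᵐᵒᵖ)} (ha₁ : ∀ D, 𝒟 D → 𝒞 (charLeft D))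
    (ha₂ : ∀ C, 𝒞 C → 𝒟 (charRight C)) {A : ModuleCat.{u} R} (hA : coresTilde 𝒞 A) :
    resTilde 𝒟 (charRight A) := by
  obtain ⟨X, ε, d, hX, hres, hom⟩ := hA
  refine ⟨fun i => charRight (X i), charRightMap ε, fun i => charRightMap (d i),
    fun i => ha₂ _ (hX i), ⟨?_, ?_, fun i => ?_⟩,
    fun D hD => ⟨?_, ?_, fun i => ?_⟩⟩
  · exact (ModuleCat.epi_iff_surjective _).2 (charRightMap_surjective _
      ((ModuleCat.mono_iff_injective _).1 hres.mono))
  · obtain ⟨h, hex⟩ := hres.exact_zero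
    exact ⟨_, charRightShortComplex_exact hex⟩
  · obtain ⟨h, hex⟩ := hres.exact_succ i
    exact ⟨_, charRightShortComplex_exact hex⟩
  · exact (surjective_comp_iff ε D).1 (hom _ (ha₁ D hD)).surjective
  · exact (exact_comp_iff ε (d 0) D).1 (hom _ (ha₁ D hD)).exact_zero
  · exact (exact_comp_iff (d i) (d (i + 1)) D).1 ((hom _ (ha₁ D hD)).exact_succ i)

/-- The stable condition on the dual passes from `A` to the cokernel of any `𝒞`-preenvelope of `A`,
so the preenvelopes can be spliced indefinitely. -/
lemma coresTilde_of_stableResTilde_charRight {𝒞 : ObjectProperty (ModuleCat.{u} R)}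
    {𝒟 : ObjectProperty (ModuleCat.{u} Rᵐᵒᵖ)} [𝒟.IsClosedUnderIsomorphisms]
    [𝒟.IsClosedUnderFiniteProducts] (ha₁ : ∀ D, 𝒟 D → 𝒞 (charLeft D))
    (ha₂ : ∀ C, 𝒞 C → 𝒟 (charRight C)) (hb : IsPreenveloping 𝒞) {A : ModuleCat.{u} R}
    (hA : stableResTilde 𝒟 (charRight A)) : coresTilde 𝒞 A := by
  refine coresTilde_of_preenvelope_step 𝒞 (fun A => stableResTilde 𝒟 (charRight A))
    (fun A hA => ?_) A hA
  obtain ⟨X, f, hf⟩ := hb A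
  have hmono : Mono f := by
    obtain ⟨K, Y, D, k, p, -, hY, -, -, -, hp, -⟩ := hA.exists_step
    let t : Y ⟶ charRight A :=
      ModuleCat.ofHom (X := Y) (Y := charRight A) (LinearMap.fst Rᵐᵒᵖ _ _ ∘ₗ p)
    have ht : Function.Surjective t.hom := Prod.fst_surjective.comp hp
    -- An element killed by this map is killed by every character, as `t` is onto `A⁺`. The
    -- resulting embedding of `A` in `Y⁺` factors through `f`.
    have : Mono ((flip A Y).symm t) := by
      refine (ModuleCat.mono_iff_injective _).2 ((injective_iff_map_eq_zero _).2 fun a h => ?_)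
      refine by_contra fun ha => ?_
      obtain ⟨φ, hφ⟩ := exists_character_ne_zero ha
      obtain ⟨y, hy⟩ := ht ((charRightEquiv A).symm φ)
      refine hφ ?_
      rw [← (charRightEquiv A).apply_symm_apply φ, ← hy, ← flip_symm_apply, h]
      simp
    obtain ⟨g, hg⟩ := hf.2 _ (ha₁ Y hY) ((flip A Y).symm t)
    exact mono_of_mono_fac hg
  have hS : (ShortComplex.mk f (Limits.cokernel.π f) (Limits.cokernel.condition _)).ShortExact :=
    .mk' (ShortComplex.exact_cokernel _) inferInstance inferInstance
  refine ⟨X, Limits.cokernel f, f, Limits.cokernel.π f, Limits.cokernel.condition f, hf, hS, ?_⟩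
  exact stableResTilde.kernel_of_precover (charRightShortComplex_shortExact hS) (ha₂ X hf.1)
    (fun D hD => (surjective_comp_iff f D).1 (hf.2 _ (ha₁ D hD))) hA

end Main

end GorensteinSub

theorem proposition3p2 {R : Type u} [Ring R]
    (𝒞 : ObjectProperty (ModuleCat.{u} R)) (𝒟 : ObjectProperty (ModuleCat.{u} Rᵐᵒᵖ))
    [𝒞.IsClosedUnderIsomorphisms] [𝒞.IsClosedUnderFiniteProducts]
    [𝒟.IsClosedUnderIsomorphisms] [𝒟.IsClosedUnderFiniteProducts]
    (ha₁ : ∀ D : ModuleCat.{u} Rᵐᵒᵖ, 𝒟 D → 𝒞 (GorensteinSub.charLeft D))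
    (ha₂ : ∀ C : ModuleCat.{u} R, 𝒞 C → 𝒟 (GorensteinSub.charRight C))
    (hb₁ : GorensteinSub.IsPreenveloping 𝒞)
    (hb₂ : ∀ C : ModuleCat.{u} R, 𝒞 C → GorensteinSub.IsPureInjective C)
    (hc : ∀ (D : ModuleCat.{u} Rᵐᵒᵖ) (C : ModuleCat.{u} R), 𝒟 D → 𝒞 C →
      GorensteinSub.ExtVanish.{u} D (GorensteinSub.charRight C))
    (A : ModuleCat.{u} R) :
    GorensteinSub.rightGorenstein.{u} 𝒞 A ↔
      GorensteinSub.leftGorenstein.{u} 𝒟 (GorensteinSub.charRight A) := by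
  refine ⟨fun ⟨hperp, hres⟩ => ⟨fun D hD => ?_, ?_⟩, fun ⟨hperp, hres⟩ => ⟨fun C hC => ?_, ?_⟩⟩
  · exact (GorensteinSub.extVanish_charLeft_iff A D).1 (hperp _ (ha₁ D hD))
  · exact GorensteinSub.resTilde_charRight ha₁ ha₂ hres
  -- Orthogonality to `C⁺⁺` comes from `C⁺` lying in `𝒟`, and descends to its retract `C`.
  · obtain ⟨ρ, hρ⟩ := (hb₂ C hC).exists_retraction
    exact ((GorensteinSub.extVanish_charLeft_iff A _).2 (hperp _ (ha₂ C hC))).of_retract _ ρ hρ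
  · exact GorensteinSub.coresTilde_of_stableResTilde_charRight ha₁ ha₂ hb₁ hres.stableResTilde
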